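/- Let $p\in(0,1)$ be fixed and let $m\ge 0$ be an even integer. For $n\ge 1$ let $G(n,p)$ be the Erdős–Rényi random graph on $n$ labelled vertices, in which each of the $\binom n2$ possible edges is present with probability $p$, independently of the others. Let $N$ be a standard normal random variable. (a) For all integers $k\ge 1$ and $l$ there is a constant $C=C(m,l,k)$, which may also depend on the fixed $p$ but on nothing else, such that the following holds. Let $H$ be any graph with $k$ edges and $l$ vertices, let $n\ge l$, and let $Y$ be the number of (not necessarily induced) subgraphs of $G(n,p)$ that are isomorphic to $H$. Then $\mathbb V Y>0$, and $Z:=(Y-\mathbb E Y)/\sqrt{\mathbb V Y}$ satisfies $$\bigl|\mathbb E(Z^m)-\mathbb E(N^m)\bigr|\le \frac{C}{n^2}.$$ (b) In particular, there is a constant $C$ depending only on $m$ and $p$ such that for every $n\ge 3$ the number $T$ of triangles in $G(n,p)$ satisfies $\mathbb V T>0$ and, with $Z:=(T-\mathbb E T)/\sqrt{\mathbb V T}$, $$\bigl|\mathbb E(Z^m)-\mathbb E(N^m)\bigr|\le \frac{C}{n^2}.$$ -/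

import Mathlib

open MeasureTheory ProbabilityTheory
open scoped SimpleGraph

/-- The standardisation `(X - 𝔼 X) / √(Var X)` of a real random variable `X`
on the probability space `(Ω, μ)`. -/
noncomputable def standardised {Ω : Type*} [MeasurableSpace Ω] (μ : Measure Ω) (X : Ω → ℝ) :
    Ω → ℝ :=
  fun ω => (X ω - ∫ ω', X ω' ∂μ) / Real.sqrt (variance X μ)

/-- The number of subgraphs of the graph `G` on `{0, …, n - 1}` that are isomorphic to `H`,
as a real number. -/
noncomputable def subgraphCount {V : Type*} (H : SimpleGraph V) (n : ℕ)
    (G : SimpleGraph (Fin n)) : ℝ :=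
  (G.copyCount H : ℝ)

/-- The number of triangles of `G`: the number of `3`-element sets of vertices
any two of which are adjacent, as a real number. -/
noncomputable def triangleCount (n : ℕ) (G : SimpleGraph (Fin n)) : ℝ :=
  ({s : Finset (Fin n) | G.IsNClique 3 s}.ncard : ℝ)

/-- The `m`-th moment of a standard normal random variable. -/
noncomputable def normalMoment (m : ℕ) : ℝ :=
  ∫ x : ℝ, x ^ m ∂(gaussianReal 0 1)

/-! The centred count `Y - 𝔼 Y` is the sum of the centred indicators of the copies of `H` in the
complete graph. These are bounded, and independent across disjoint edge sets. With `l` fixed there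
are at most `a = O(n ^ l)` copies, and at most `b = O(n ^ (l - 2))` of them use a given edge.

Expand the `r`-th moment `M_r` over `r`-tuples of copies. A tuple with a member disjoint from all
others contributes nothing. If a distinguished member meets just one other, and no further member
meets these two, the contribution factorises (`pairingDefect_eq_zero`). Hence `M_r = (r - 1) M_2
M_(r-2)`, up to tuples without isolated members whose distinguished member lies in a connected
triple. This is the Gaussian recursion with an error (`abs_sumMoment_sub_le`).

The triple costs `a * b ^ 2`. For `r = 2q` an odd number `2q - 3` of members remains, which cannot
all be paired off; this costs a factor `b` where parity-blind counting would give `√(ab)`. The error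
is thus `O((ab) ^ q * b / a)` (`card_hasTriple_le`, `tupleBound_odd`). Parity is what improves the
rate from `n⁻¹` to `n⁻²`.

Dividing by `M_2 ^ q` requires `M_2 ≥ c * a * b`. Copies sharing `t` edges have covariance at least
a constant times `t`, and Cauchy–Schwarz over the edges bounds the total overlap from below
(`le_sumMoment_two`). -/

namespace Dissociated

/-! ### Counting tuples without isolated members -/

section Counting

open Classical in
/-- If `P f` constrains the value `f i` to a set of size at most `N₁`, and, given this value, the
restriction of `f` to the other indices to a set of size at most `N₂`, then at most `N₁ * N₂`
functions satisfy `P`. -/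
lemma card_filter_le_mul {ι 𝒜 : Type*} [Fintype ι] [DecidableEq ι] [Fintype 𝒜] (i : ι) (P : (ι → 𝒜) → Prop)
    (Q : 𝒜 → Prop) (R : 𝒜 → ({j // j ≠ i} → 𝒜) → Prop) [DecidablePred P] [DecidablePred Q]
    [∀ α, DecidablePred (R α)] {N₁ N₂ : ℕ}
    (h : ∀ f, P f → Q (f i) ∧ R (f i) (fun j => f j))
    (hQ : (Finset.univ.filter Q).card ≤ N₁)
    (hR : ∀ α, Q α → (Finset.univ.filter (R α)).card ≤ N₂) :
    (Finset.univ.filter P).card ≤ N₁ * N₂ := by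
  calc (Finset.univ.filter P).card
      ≤ ((Finset.univ.filter Q).sigma fun α => Finset.univ.filter (R α)).card := by
        refine Finset.card_le_card_of_injOn (fun f => ⟨f i, fun j => f j⟩) ?_ ?_
        · intro f hf
          simpa using h f (by simpa using hf)
        · intro f _ f' _ hff
          simp only [Sigma.mk.injEq, heq_eq_eq] at hff
          funext j
          by_cases hj : j = i
          · exact hj ▸ hff.1
          · exact congrFun hff.2 ⟨j, hj⟩
    _ = ∑ α ∈ Finset.univ.filter Q, (Finset.univ.filter (R α)).card := Finset.card_sigma _ _
    _ ≤ ∑ α ∈ Finset.univ.filter Q, N₂ := Finset.sum_le_sum fun α hα => hR α (by simpa using hα)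
    _ ≤ N₁ * N₂ := by
        rw [Finset.sum_const, smul_eq_mul]
        exact Nat.mul_le_mul_right _ hQ

/-- The order of magnitude of the number of `r`-tuples without isolated members. -/
def tupleBound (a b : ℕ) : ℕ → ℕ
  | 0 => 1
  | 1 => b
  | r + 2 => a * b * tupleBound a b r

lemma mul_tupleBound_le {a b : ℕ} (hab : b ≤ a) :
    ∀ r, b * tupleBound a b r ≤ tupleBound a b (r + 1)
  | 0 => by simp [tupleBound]
  | 1 => by simpa [tupleBound] using Nat.mul_le_mul_right b hab
  | r + 2 => by
    have := mul_tupleBound_le hab r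
    calc b * (a * b * tupleBound a b r) = a * b * (b * tupleBound a b r) := by ring
      _ ≤ a * b * tupleBound a b (r + 1) := Nat.mul_le_mul_left _ this

lemma tupleBound_odd (a b : ℕ) : ∀ q, tupleBound a b (2 * q + 1) = b * (a * b) ^ q
  | 0 => by simp [tupleBound]
  | q + 1 => by
    rw [show 2 * (q + 1) + 1 = (2 * q + 1) + 2 by ring, tupleBound, tupleBound_odd a b q]
    ring

/-- The constant in the bound for the number of `r`-tuples without isolated members, for sets of
size at most `k` and a set of size at most `s` of additional elements. -/
def tupleConst (k : ℕ) : ℕ → ℕ → ℕ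
  | 0, _ => 1
  | 1, s => s
  | r + 2, s => s * tupleConst k (r + 1) (s + k) + (r + 1) * k * tupleConst k r (s + 2 * k)

/-- A finite family of sets `E α` of size at most `k`, with at most `a` members, of which at most
`b` contain any given element. -/
structure SparseFamily {𝒜 ε : Type} [Fintype 𝒜] [DecidableEq ε] (E : 𝒜 → Finset ε)
    (k a b : ℕ) : Prop where
  card_le : ∀ α, (E α).card ≤ k
  card_univ_le : Fintype.card 𝒜 ≤ a
  degree_le : ∀ e, (Finset.univ.filter fun α => e ∈ E α).card ≤ b
  le : b ≤ a

variable {ι 𝒜 ε : Type} [DecidableEq ε]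

/-- Each of the sets `E (f i)` meets `S` or another one of these sets. -/
def NoIsolated (E : 𝒜 → Finset ε) (S : Finset ε) (f : ι → 𝒜) : Prop :=
  ∀ i, ¬ Disjoint (E (f i)) S ∨ ∃ j, j ≠ i ∧ ¬ Disjoint (E (f i)) (E (f j))

variable {E : 𝒜 → Finset ε} {k a b : ℕ}

/-- A member whose only neighbour was the removed one now meets the enlarged `S`. The parameter `S`
exists so that members can be removed one at a time in an induction. -/
lemma NoIsolated.restrict {S : Finset ε} {f : ι → 𝒜} (hf : NoIsolated E S f) (i : ι) :
    NoIsolated E (S ∪ E (f i)) (fun j : {j // j ≠ i} => f j) := by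
  intro t
  rcases hf t with h | ⟨j, hj, h⟩
  · left
    rw [Finset.disjoint_union_right]
    tauto
  · by_cases hji : j = i
    · left
      rw [Finset.disjoint_union_right]
      subst hji
      tauto
    · exact Or.inr ⟨⟨j, hji⟩, by simpa [Subtype.ext_iff] using hj, h⟩

variable [Fintype 𝒜]

open Classical in
lemma SparseFamily.card_not_disjoint_le (h : SparseFamily E k a b) (S : Finset ε) :
    (Finset.univ.filter fun α => ¬ Disjoint (E α) S).card ≤ S.card * b := by
  calc _ ≤ (S.biUnion fun e => Finset.univ.filter fun α => e ∈ E α).card := by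
        refine Finset.card_le_card fun α hα => ?_
        simp only [Finset.mem_filter, Finset.mem_univ, true_and, Finset.not_disjoint_iff] at hα
        obtain ⟨e, he, heS⟩ := hα
        simpa using ⟨e, heS, he⟩
    _ ≤ S.card * b := Finset.card_biUnion_le_card_mul _ _ _ fun e _ => h.degree_le e

-- Choose an index `i`. Either `E (f i)` meets `S`, which leaves `s * b` choices and `r - 1`
-- indices, or it meets some `E (f j)`, which leaves `a` choices for `f i`, `k * b` for `f j`, and
-- `r - 2` indices. The chosen sets are absorbed into `S`, whose size therefore has to vary in the
-- induction.
open Classical in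
lemma SparseFamily.card_noIsolated_le (h : SparseFamily E k a b) (r : ℕ) :
    ∀ {s : ℕ} {ι : Type} [Fintype ι] [DecidableEq ι] (S : Finset ε), Fintype.card ι = r → S.card ≤ s →
      (Finset.univ.filter fun f : ι → 𝒜 => NoIsolated E S f).card
        ≤ tupleConst k r s * tupleBound a b r := by
  induction r using Nat.strong_induction_on with
  | _ r ih =>
  intro s ι _ _ S hι hS
  match r, ih, hι with
  | 0, _, hι =>
    have := Fintype.card_eq_zero_iff.1 hι
    refine (Finset.card_le_univ _).trans ?_
    simp [tupleConst, tupleBound]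
  | 1, _, hι =>
    obtain ⟨i, hi⟩ := Fintype.card_eq_one_iff.1 hι
    refine (card_filter_le_mul i _ (fun α => ¬ Disjoint (E α) S) (fun _ _ => True) (N₂ := 1) ?_
      ((h.card_not_disjoint_le S).trans (Nat.mul_le_mul_right b hS)) ?_).trans ?_
    · intro f hf
      rcases hf i with hi' | ⟨j, hj, _⟩
      · exact ⟨hi', trivial⟩
      · exact absurd (hi j) hj
    · intro α _
      have : IsEmpty {j // j ≠ i} := ⟨fun j => j.2 (hi j)⟩
      refine (Finset.card_le_univ _).trans ?_
      simp
    · simp [tupleConst, tupleBound]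
  | r + 2, ih, hι =>
    have hne : Nonempty ι := Fintype.card_pos_iff.1 (by omega)
    obtain ⟨i⟩ := hne
    have hcard : Fintype.card {j // j ≠ i} = r + 1 := by
      rw [Fintype.card_subtype_compl, Fintype.card_subtype_eq, hι]; omega
    set F₁ := Finset.univ.filter fun f : ι → 𝒜 => ¬ Disjoint (E (f i)) S ∧ NoIsolated E S f
    set F₂ := fun j : {j // j ≠ i} => Finset.univ.filter fun f : ι → 𝒜 =>
      ¬ Disjoint (E (f i)) (E (f j)) ∧ NoIsolated E S f
    have hsub : (Finset.univ.filter fun f : ι → 𝒜 => NoIsolated E S f)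
        ⊆ F₁ ∪ Finset.univ.biUnion F₂ := by
      intro f hf
      have hf' : NoIsolated E S f := by simpa using hf
      rcases hf' i with hi | ⟨j, hj, hij⟩
      · exact Finset.mem_union_left _ (by simp [F₁, hi, hf'])
      · refine Finset.mem_union_right _ (Finset.mem_biUnion.2 ⟨⟨j, hj⟩, Finset.mem_univ _, ?_⟩)
        simp [F₂, hij, hf']
    have h1 : F₁.card ≤ (s * b) * (tupleConst k (r + 1) (s + k) * tupleBound a b (r + 1)) := by
      refine card_filter_le_mul i (fun f => ¬ Disjoint (E (f i)) S ∧ NoIsolated E S f)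
        (fun α => ¬ Disjoint (E α) S) (fun α g => NoIsolated E (S ∪ E α) g) (fun f hf => ⟨hf.1, hf.2.restrict i⟩)
        ((h.card_not_disjoint_le S).trans (Nat.mul_le_mul_right b hS)) fun α _ => ?_
      have hc : (S ∪ E α).card ≤ s + k :=
        (Finset.card_union_le _ _).trans (add_le_add hS (h.card_le α))
      exact ih (r + 1) (by omega) (S ∪ E α) hcard hc
    have h2 : ∀ j, (F₂ j).card
        ≤ a * ((k * b) * (tupleConst k r (s + 2 * k) * tupleBound a b r)) := by
      intro j
      refine card_filter_le_mul i
        (fun f => ¬ Disjoint (E (f i)) (E (f j)) ∧ NoIsolated E S f) (fun _ => True)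
        (fun α g => ¬ Disjoint (E (g j)) (E α) ∧ NoIsolated E (S ∪ E α) g)
        (fun f hf => ⟨trivial, fun hd => hf.1 hd.symm, hf.2.restrict i⟩)
        ((Finset.card_le_univ _).trans h.card_univ_le) fun α _ => ?_
      refine card_filter_le_mul j _ (fun β => ¬ Disjoint (E β) (E α))
        (fun β g => NoIsolated E (S ∪ E α ∪ E β) g) (fun g hg => ⟨hg.1, hg.2.restrict j⟩)
        ((h.card_not_disjoint_le _).trans (Nat.mul_le_mul_right b (h.card_le α))) fun β _ => ?_
      have hc : (S ∪ E α ∪ E β).card ≤ s + 2 * k := by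
        have h3 := Finset.card_union_le (S ∪ E α) (E β)
        have h4 := Finset.card_union_le S (E α)
        have h5 := h.card_le α
        have h6 := h.card_le β
        omega
      have hc' : Fintype.card {t // t ≠ j} = r := by
        rw [Fintype.card_subtype_compl, Fintype.card_subtype_eq, hcard]; omega
      exact ih r (by omega) (S ∪ E α ∪ E β) hc' hc
    calc _ ≤ F₁.card + (Finset.univ.biUnion F₂).card :=
          (Finset.card_le_card hsub).trans (Finset.card_union_le _ _)
      _ ≤ (s * b) * (tupleConst k (r + 1) (s + k) * tupleBound a b (r + 1))
          + (r + 1) * (a * ((k * b) * (tupleConst k r (s + 2 * k) * tupleBound a b r))) := by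
          refine add_le_add h1 ((Finset.card_biUnion_le_card_mul _ _ _ fun j _ => h2 j).trans ?_)
          rw [Finset.card_univ, hcard]
      _ = s * tupleConst k (r + 1) (s + k) * (b * tupleBound a b (r + 1))
          + (r + 1) * k * tupleConst k r (s + 2 * k) * (a * b * tupleBound a b r) := by ring
      _ ≤ s * tupleConst k (r + 1) (s + k) * tupleBound a b (r + 2)
          + (r + 1) * k * tupleConst k r (s + 2 * k) * tupleBound a b (r + 2) :=
          add_le_add (Nat.mul_le_mul_left _ (mul_tupleBound_le h.le _)) le_rfl
      _ = _ := by rw [tupleConst]; ring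

end Counting
end Dissociated

namespace Dissociated

/-! ### Approximate Gaussian recursion for the moments of a dissociated sum -/

section Moments

variable {ι Ω 𝒜 ε : Type}

/-- A family of centred random variables `X α`, with respect to the expectation functional `Ex`,
all whose mixed moments are bounded by one and which are independent when the sets `E α` attached
to them are disjoint. -/
structure IsDissociated (Ex : (Ω → ℝ) →ₗ[ℝ] ℝ) (X : 𝒜 → Ω → ℝ) (E : 𝒜 → Finset ε) : Prop where
  one : Ex 1 = 1
  centred : ∀ α, Ex (X α) = 0
  abs_le_one : ∀ {ι : Type} (f : ι → 𝒜) (T : Finset ι), |Ex (fun ω => ∏ i ∈ T, X (f i) ω)| ≤ 1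
  mul : ∀ {ι : Type} (f : ι → 𝒜) (T U : Finset ι),
    (∀ i ∈ T, ∀ j ∈ U, Disjoint (E (f i)) (E (f j))) →
    Ex (fun ω => (∏ i ∈ T, X (f i) ω) * ∏ i ∈ U, X (f i) ω) =
      Ex (fun ω => ∏ i ∈ T, X (f i) ω) * Ex (fun ω => ∏ i ∈ U, X (f i) ω)

/-- The mixed moment of the random variables `X (f i)` with `i ∈ T`. -/
def mixedMoment (Ex : (Ω → ℝ) →ₗ[ℝ] ℝ) (X : 𝒜 → Ω → ℝ) (f : ι → 𝒜) (T : Finset ι) : ℝ :=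
  Ex (fun ω => ∏ i ∈ T, X (f i) ω)

variable {Ex : (Ω → ℝ) →ₗ[ℝ] ℝ} {X : 𝒜 → Ω → ℝ} {E : 𝒜 → Finset ε}

lemma IsDissociated.mixedMoment_union [DecidableEq ι] (h : IsDissociated Ex X E) (f : ι → 𝒜)
    {T U : Finset ι} (hTU : Disjoint T U)
    (hd : ∀ i ∈ T, ∀ j ∈ U, Disjoint (E (f i)) (E (f j))) :
    mixedMoment Ex X f (T ∪ U) = mixedMoment Ex X f T * mixedMoment Ex X f U := by
  simp only [mixedMoment, ← h.mul f T U hd, Finset.prod_union hTU]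

lemma IsDissociated.mixedMoment_singleton (h : IsDissociated Ex X E) (f : ι → 𝒜) (i : ι) :
    mixedMoment Ex X f {i} = 0 := by
  simpa [mixedMoment] using h.centred (f i)

lemma IsDissociated.mixedMoment_eq_zero [DecidableEq ι] (h : IsDissociated Ex X E) (f : ι → 𝒜)
    {T : Finset ι} {t : ι} (ht : t ∈ T) (hd : ∀ j ∈ T, j ≠ t → Disjoint (E (f t)) (E (f j))) :
    mixedMoment Ex X f T = 0 := by
  rw [← Finset.insert_erase ht, Finset.insert_eq, h.mixedMoment_union f (by simp),
    h.mixedMoment_singleton, zero_mul]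
  intro i hi j hj
  rw [Finset.mem_singleton.1 hi]
  exact hd j (Finset.mem_of_mem_erase hj) (Finset.ne_of_mem_erase hj)

variable [Fintype ι] [DecidableEq ι]

/-- The difference between the mixed moment of all `X (f i)` and the sum of the products obtained
by pairing off the index `i₀` with another index. -/
def pairingDefect (Ex : (Ω → ℝ) →ₗ[ℝ] ℝ) (X : 𝒜 → Ω → ℝ) (i₀ : ι) (f : ι → 𝒜) : ℝ :=
  mixedMoment Ex X f Finset.univ -
    ∑ j ∈ Finset.univ.erase i₀, mixedMoment Ex X f {i₀, j} * mixedMoment Ex X f {i₀, j}ᶜ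

lemma IsDissociated.abs_pairingDefect_le (h : IsDissociated Ex X E) (i₀ : ι) (f : ι → 𝒜) :
    |pairingDefect Ex X i₀ f| ≤ Fintype.card ι := by
  have h1 : ∀ j ∈ Finset.univ.erase i₀,
      |mixedMoment Ex X f {i₀, j} * mixedMoment Ex X f {i₀, j}ᶜ| ≤ 1 := fun j _ => by
    rw [abs_mul]
    exact mul_le_one₀ (h.abs_le_one _ _) (abs_nonneg _) (h.abs_le_one _ _)
  have h2 := (Finset.abs_sum_le_sum_abs _ _).trans (Finset.sum_le_sum h1)
  rw [Finset.sum_const, Finset.card_erase_of_mem (Finset.mem_univ _), Finset.card_univ,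
    nsmul_eq_mul, mul_one, Nat.cast_sub (Fintype.card_pos_iff.2 ⟨i₀⟩), Nat.cast_one] at h2
  have h3 : |mixedMoment Ex X f Finset.univ| ≤ 1 := h.abs_le_one _ _
  refine (abs_sub _ _).trans ?_
  linarith

variable [DecidableEq ε]

/-- The tuple `f` has no isolated member, and `i₀` lies in a connected triple `i₀, j, i`. -/
def HasTriple (E : 𝒜 → Finset ε) (i₀ : ι) (f : ι → 𝒜) : Prop :=
  ∃ j i, j ≠ i₀ ∧ i ≠ i₀ ∧ i ≠ j ∧ ¬ Disjoint (E (f j)) (E (f i₀)) ∧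
    ¬ Disjoint (E (f i)) (E (f i₀) ∪ E (f j)) ∧ NoIsolated E ∅ f

/-- If no member is isolated, `i₀` has a neighbour `j`, and without a triple nothing else meets
either of the two: the full moment splits off `{i₀, j}`, and every other pair `{i₀, j'}` has moment
zero by independence. -/
lemma IsDissociated.pairingDefect_eq_zero (h : IsDissociated Ex X E) (i₀ : ι) (f : ι → 𝒜)
    (hf : ¬ HasTriple E i₀ f) : pairingDefect Ex X i₀ f = 0 := by
  by_cases hiso : NoIsolated E ∅ f
  · obtain ⟨j, hj, hij⟩ : ∃ j, j ≠ i₀ ∧ ¬ Disjoint (E (f i₀)) (E (f j)) := by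
      simpa using hiso i₀
    have hfar : ∀ i, i ≠ i₀ → i ≠ j → Disjoint (E (f i)) (E (f i₀) ∪ E (f j)) := by
      intro i hi hi'
      by_contra hd
      exact hf ⟨j, i, hj, hi, hi', fun hd' => hij hd'.symm, hd, hiso⟩
    have hsum : ∑ j' ∈ Finset.univ.erase i₀,
        mixedMoment Ex X f {i₀, j'} * mixedMoment Ex X f {i₀, j'}ᶜ =
        mixedMoment Ex X f {i₀, j} * mixedMoment Ex X f {i₀, j}ᶜ := by
      refine Finset.sum_eq_single_of_mem j (by simp [hj]) fun j' hj' hne => ?_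
      have hj'' : j' ≠ i₀ := Finset.ne_of_mem_erase hj'
      rw [h.mixedMoment_eq_zero f (T := {i₀, j'}) (t := j') (by simp), zero_mul]
      intro i hi hi'
      obtain rfl : i = i₀ := by simpa [hi'] using hi
      exact (Finset.disjoint_union_right.1 (hfar j' hj'' hne)).1
    rw [pairingDefect, hsum, ← Finset.union_compl {i₀, j},
      h.mixedMoment_union f disjoint_compl_right, sub_self]
    intro i hi i' hi'
    simp only [Finset.mem_compl, Finset.mem_insert, Finset.mem_singleton, not_or] at hi'
    have hd := Finset.disjoint_union_right.1 (hfar i' hi'.1 hi'.2)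
    rcases Finset.mem_insert.1 hi with rfl | hi
    · exact hd.1.symm
    · rw [Finset.mem_singleton.1 hi]
      exact hd.2.symm
  -- An isolated `t` lies in exactly one of `{i₀, j}` and its complement, so it kills one factor of
  -- each product as well as the full moment.
  · obtain ⟨t, ht⟩ : ∃ t, ∀ j, j ≠ t → Disjoint (E (f t)) (E (f j)) := by
      simpa [NoIsolated] using hiso
    have hzero : ∀ T : Finset ι, t ∈ T → mixedMoment Ex X f T = 0 := fun T hT =>
      h.mixedMoment_eq_zero f hT fun j _ hj => ht j hj
    rw [pairingDefect, hzero _ (Finset.mem_univ _), zero_sub, neg_eq_zero]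
    refine Finset.sum_eq_zero fun j _ => ?_
    by_cases hj : t ∈ ({i₀, j} : Finset ι)
    · rw [hzero _ hj, zero_mul]
    · rw [hzero _ (Finset.mem_compl.2 hj), mul_zero]

variable [Fintype 𝒜] {k a b : ℕ}

-- There are `a` choices for `f i₀`, `k * b` for a neighbour, and `2 * k * b` for a third set
-- meeting the union of these two. The other `r` members have no isolated one relative to that
-- triple, whose union has size at most `3 * k`.
open Classical in
lemma SparseFamily.card_hasTriple_le (h : SparseFamily E k a b) {r : ℕ}
    (hι : Fintype.card ι = r + 3) (i₀ : ι) :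
    (Finset.univ.filter fun f : ι → 𝒜 => HasTriple E i₀ f).card ≤
      (r + 3) * ((r + 3) *
        (a * ((k * b) * ((2 * k * b) * (tupleConst k r (3 * k) * tupleBound a b r))))) := by
  set F : ι → ι → Finset (ι → 𝒜) := fun j i => Finset.univ.filter fun f =>
    j ≠ i₀ ∧ i ≠ i₀ ∧ i ≠ j ∧ ¬ Disjoint (E (f j)) (E (f i₀)) ∧
    ¬ Disjoint (E (f i)) (E (f i₀) ∪ E (f j)) ∧ NoIsolated E ∅ f with hF
  have hcard : ∀ j i, (F j i).card ≤
      a * ((k * b) * ((2 * k * b) * (tupleConst k r (3 * k) * tupleBound a b r))) := by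
    intro j i
    by_cases hj : j ≠ i₀
    swap
    · simp [hF, hj]
    by_cases hi : i ≠ i₀
    swap
    · simp [hF, hi]
    by_cases hij : i ≠ j
    swap
    · simp [hF, hij]
    refine card_filter_le_mul i₀ _ (fun _ => True)
      (fun α g => ¬ Disjoint (E (g ⟨j, hj⟩)) (E α) ∧
        ¬ Disjoint (E (g ⟨i, hi⟩)) (E α ∪ E (g ⟨j, hj⟩)) ∧ NoIsolated E (∅ ∪ E α) g)
      (fun f hf => ⟨trivial, hf.2.2.2.1, hf.2.2.2.2.1, hf.2.2.2.2.2.restrict i₀⟩)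
      ((Finset.card_le_univ _).trans h.card_univ_le) fun α _ => ?_
    refine card_filter_le_mul (⟨j, hj⟩ : {t // t ≠ i₀}) _ (fun β => ¬ Disjoint (E β) (E α))
      (fun β g => ¬ Disjoint (E (g ⟨⟨i, hi⟩, by simpa using hij⟩)) (E α ∪ E β) ∧
        NoIsolated E (∅ ∪ E α ∪ E β) g)
      (fun f hf => ⟨hf.1, hf.2.1, hf.2.2.restrict _⟩)
      ((h.card_not_disjoint_le _).trans (Nat.mul_le_mul_right b (h.card_le α))) fun β _ => ?_
    have hαβ : (E α ∪ E β).card ≤ 2 * k := by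
      have h1 := Finset.card_union_le (E α) (E β)
      have h2 := h.card_le α
      have h3 := h.card_le β
      omega
    refine card_filter_le_mul
      (⟨⟨i, hi⟩, by simpa using hij⟩ : {t : {t // t ≠ i₀} // t ≠ ⟨j, hj⟩}) _
      (fun γ => ¬ Disjoint (E γ) (E α ∪ E β))
      (fun γ g => NoIsolated E (∅ ∪ E α ∪ E β ∪ E γ) g)
      (fun f hf => ⟨hf.1, hf.2.restrict _⟩)
      ((h.card_not_disjoint_le _).trans (Nat.mul_le_mul_right b hαβ)) fun γ _ => ?_
    have hc : (∅ ∪ E α ∪ E β ∪ E γ).card ≤ 3 * k := by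
      rw [Finset.empty_union]
      have h1 := Finset.card_union_le (E α ∪ E β) (E γ)
      have h2 := h.card_le γ
      omega
    refine h.card_noIsolated_le r _ ?_ hc
    rw [Fintype.card_subtype_compl, Fintype.card_subtype_eq, Fintype.card_subtype_compl,
      Fintype.card_subtype_eq, Fintype.card_subtype_compl, Fintype.card_subtype_eq, hι]
    omega
  calc _ ≤ (Finset.univ.biUnion fun j => Finset.univ.biUnion fun i => F j i).card := by
        refine Finset.card_le_card fun f hf => ?_
        obtain ⟨j, i, hji⟩ : HasTriple E i₀ f := by simpa using hf
        simp only [Finset.mem_biUnion, Finset.mem_univ, true_and]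
        exact ⟨j, i, by simpa [hF] using hji⟩
    _ ≤ _ := by
        rw [← hι, ← Finset.card_univ]
        exact Finset.card_biUnion_le_card_mul _ _ _ fun j _ =>
          Finset.card_biUnion_le_card_mul _ _ _ fun i _ => hcard j i

lemma sum_prod_fiber (y z : 𝒜 → ℝ) (T : Finset ι) :
    ∑ f : ι → 𝒜, (∏ i ∈ T, y (f i)) * ∏ i ∈ Tᶜ, z (f i) =
      (∑ α, y α) ^ T.card * (∑ α, z α) ^ Tᶜ.card := by
  have h1 : ∀ f : ι → 𝒜, (∏ i ∈ T, y (f i)) * ∏ i ∈ Tᶜ, z (f i) =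
      ∏ i, if i ∈ T then y (f i) else z (f i) := fun f => by
    rw [← Finset.prod_mul_prod_compl T]
    congr 1
    · exact Finset.prod_congr rfl fun i hi => by simp [hi]
    · exact Finset.prod_congr rfl fun i hi => by simp [Finset.mem_compl.1 hi]
  have h2 : ∀ i, (∑ α, if i ∈ T then y α else z α) = if i ∈ T then ∑ α, y α else ∑ α, z α :=
    fun i => by split_ifs <;> rfl
  simp_rw [h1]
  rw [← Fintype.piFinset_univ, Finset.sum_prod_piFinset Finset.univ
    fun i α => if i ∈ T then y α else z α]
  simp_rw [h2]
  rw [← Finset.prod_mul_prod_compl T]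
  congr 1
  · rw [Finset.prod_congr rfl fun i hi => if_pos hi, Finset.prod_const]
  · rw [Finset.prod_congr rfl fun i hi => if_neg (Finset.mem_compl.1 hi), Finset.prod_const]

/-- The moment of order `r` of the sum of the random variables `X α`. -/
def sumMoment (Ex : (Ω → ℝ) →ₗ[ℝ] ℝ) (X : 𝒜 → Ω → ℝ) (r : ℕ) : ℝ :=
  Ex fun ω => (∑ α, X α ω) ^ r

-- The factors depend on complementary coordinates of `f`, so the sum over `f` splits. The product
-- of expectations is handled as an iterated expectation over independent `ω` and `ω'`, where
-- `sum_prod_fiber` applies pointwise.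
omit [DecidableEq ε] in
lemma sum_mixedMoment_mul_compl (T : Finset ι) :
    ∑ f : ι → 𝒜, mixedMoment Ex X f T * mixedMoment Ex X f Tᶜ =
      sumMoment Ex X T.card * sumMoment Ex X Tᶜ.card := by
  have hc : ∀ (c : ℝ) (g : Ω → ℝ), c * Ex g = Ex fun ω => c * g ω := fun c g =>
    (Ex.map_smul c g).symm
  have hs : ∀ g : (ι → 𝒜) → Ω → ℝ, ∑ f, Ex (g f) = Ex fun ω => ∑ f, g f ω := fun g => by
    rw [← map_sum]
    congr 1
    ext ω
    simp
  simp only [mixedMoment, sumMoment]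
  simp_rw [hc, hs]
  congr 1
  ext ω
  rw [mul_comm, hc]
  simp_rw [mul_comm (Ex _), hc, hs]
  congr 1
  ext ω'
  rw [mul_comm, ← sum_prod_fiber]
  exact Finset.sum_congr rfl fun f _ => mul_comm _ _

omit [DecidableEq ε] in
lemma IsDissociated.sum_mixedMoment_univ (h : IsDissociated Ex X E) :
    ∑ f : ι → 𝒜, mixedMoment Ex X f Finset.univ = sumMoment Ex X (Fintype.card ι) := by
  have h1 : sumMoment Ex X 0 = 1 := by
    rw [← h.one]
    simp only [sumMoment, pow_zero]
    rfl
  have h2 : ∀ f : ι → 𝒜, mixedMoment Ex X f ∅ = 1 := fun f => by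
    rw [← h.one]
    simp only [mixedMoment, Finset.prod_empty]
    rfl
  simpa [h1, h2] using sum_mixedMoment_mul_compl (Ex := Ex) (X := X) (Finset.univ : Finset ι)

omit [DecidableEq ε] in
lemma IsDissociated.sum_pairingDefect (h : IsDissociated Ex X E) {r : ℕ}
    (hι : Fintype.card ι = r + 2) (i₀ : ι) :
    ∑ f : ι → 𝒜, pairingDefect Ex X i₀ f =
      sumMoment Ex X (r + 2) - (r + 1) * (sumMoment Ex X 2 * sumMoment Ex X r) := by
  simp only [pairingDefect]
  rw [Finset.sum_sub_distrib, h.sum_mixedMoment_univ, hι, Finset.sum_comm]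
  have h1 : ∀ j ∈ Finset.univ.erase i₀,
      ∑ f : ι → 𝒜, mixedMoment Ex X f {i₀, j} * mixedMoment Ex X f {i₀, j}ᶜ =
        sumMoment Ex X 2 * sumMoment Ex X r := fun j hj => by
    rw [sum_mixedMoment_mul_compl, Finset.card_compl, hι,
      Finset.card_pair (Finset.ne_of_mem_erase hj).symm, Nat.add_sub_cancel]
  rw [Finset.sum_congr rfl h1, Finset.sum_const, Finset.card_erase_of_mem (Finset.mem_univ _),
    Finset.card_univ, hι, nsmul_eq_mul]
  push_cast [Nat.add_sub_cancel]
  norm_num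

/-- The constant in the approximate recursion for the moments. -/
def recursionConst (k r : ℕ) : ℕ := (r + 3) ^ 3 * (2 * k ^ 2 * tupleConst k r (3 * k))

/-- Summing the pairing defects over all tuples gives the left side. Only tuples with a triple
contribute, each at most `r + 3`. -/
lemma IsDissociated.abs_sumMoment_sub_le (h : IsDissociated Ex X E) (hE : SparseFamily E k a b)
    (r : ℕ) :
    |sumMoment Ex X (r + 3) - (r + 2) * (sumMoment Ex X 2 * sumMoment Ex X (r + 1))| ≤
      recursionConst k r * (a * b ^ 2 * tupleBound a b r) := by
  classical
  have hι : Fintype.card (Fin (r + 3)) = r + 3 := Fintype.card_fin _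
  have h1 := h.sum_pairingDefect (r := r + 1) hι 0
  have h2 : sumMoment Ex X (r + 3) - (r + 2) * (sumMoment Ex X 2 * sumMoment Ex X (r + 1)) =
      ∑ f : Fin (r + 3) → 𝒜, pairingDefect Ex X 0 f := by
    rw [h1]
    push_cast
    ring
  have h3 : ∀ f : Fin (r + 3) → 𝒜, |pairingDefect Ex X 0 f| ≤
      if HasTriple E 0 f then ((r + 3 : ℕ) : ℝ) else 0 := fun f => by
    split_ifs with hf
    · simpa only [hι] using h.abs_pairingDefect_le 0 f
    · rw [h.pairingDefect_eq_zero 0 f hf, abs_zero]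
  have h4 := hE.card_hasTriple_le hι 0
  rw [h2]
  calc _ ≤ ∑ f : Fin (r + 3) → 𝒜, |pairingDefect Ex X 0 f| := Finset.abs_sum_le_sum_abs _ _
    _ ≤ ∑ f : Fin (r + 3) → 𝒜, if HasTriple E 0 f then ((r + 3 : ℕ) : ℝ) else 0 :=
        Finset.sum_le_sum fun f _ => h3 f
    _ = ((Finset.univ.filter fun f : Fin (r + 3) → 𝒜 => HasTriple E 0 f).card * (r + 3) : ℕ) := by
        rw [← Finset.sum_filter, Finset.sum_const, nsmul_eq_mul, Nat.cast_mul]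
    _ ≤ (((r + 3) * ((r + 3) * (a * ((k * b) * ((2 * k * b) *
          (tupleConst k r (3 * k) * tupleBound a b r)))))) * (r + 3) : ℕ) :=
        Nat.cast_le.2 (Nat.mul_le_mul_right _ h4)
    _ = _ := by
        rw [recursionConst]
        push_cast
        ring

/-- The normalised even moments of the sum of a dissociated family whose variance is at least of
order `a * b` are within `O(b / a)` of those of the normal distribution. -/
theorem exists_abs_sumMoment_div_sub_le {N : ℕ → ℝ} (hN0 : N 0 = 1)
    (hN : ∀ q, N (q + 1) = (2 * q + 1) * N q) (k : ℕ) {c : ℝ} (hc : 0 < c) (q : ℕ) :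
    ∃ C : ℝ, ∀ {Ω 𝒜 ε : Type} [Fintype 𝒜] [DecidableEq ε] {Ex : (Ω → ℝ) →ₗ[ℝ] ℝ}
      {X : 𝒜 → Ω → ℝ} {E : 𝒜 → Finset ε} {a b : ℕ}, IsDissociated Ex X E →
      SparseFamily E k a b → 0 < b → c * (a * b) ≤ sumMoment Ex X 2 →
      |sumMoment Ex X (2 * q) / sumMoment Ex X 2 ^ q - N q| ≤ C * (b / a) := by
  induction q with
  | zero =>
    refine ⟨0, fun {Ω 𝒜 ε _ _ Ex X E a b} h _ _ _ => ?_⟩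
    have h1 : sumMoment Ex X 0 = 1 := by
      rw [← h.one]
      simp only [sumMoment, pow_zero]
      rfl
    simp [h1, hN0]
  | succ q ih =>
    obtain ⟨C, hC⟩ := ih
    -- The normalised second moment is exactly 1; the recursion with its triples starts at the
    -- fourth.
    rcases q with _ | q
    · refine ⟨0, fun {Ω 𝒜 ε _ _ Ex X E a b} h hE hb hv => ?_⟩
      have ha : 0 < a := hb.trans_le hE.le
      have hv0 : 0 < sumMoment Ex X 2 := lt_of_lt_of_le (by positivity) hv
      simp [hN, hN0, hv0.ne']
    · refine ⟨recursionConst k (2 * q + 1) / c ^ (q + 2) + (2 * q + 3) * C,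
        fun {Ω 𝒜 ε _ _ Ex X E a b} h hE hb hv => ?_⟩
      have ha : 0 < a := hb.trans_le hE.le
      have ha' : (0 : ℝ) < a := Nat.cast_pos.2 ha
      have hb' : (0 : ℝ) < b := Nat.cast_pos.2 hb
      have hv0 : 0 < sumMoment Ex X 2 := lt_of_lt_of_le (by positivity) hv
      have h1 := h.abs_sumMoment_sub_le hE (2 * q + 1)
      have h2 := hC h hE hb hv
      rw [tupleBound_odd] at h1
      set v := sumMoment Ex X 2
      set K : ℝ := (recursionConst k (2 * q + 1) : ℝ)
      have hK : 0 ≤ K := Nat.cast_nonneg _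
      rw [show 2 * (q + 1 + 1) = 2 * q + 1 + 3 by ring, hN (q + 1)]
      rw [show 2 * (q + 1) = 2 * q + 1 + 1 by ring] at h2
      set M := sumMoment Ex X (2 * q + 1 + 3)
      set M' := sumMoment Ex X (2 * q + 1 + 1)
      -- The new recursion error plus the inherited one, multiplied by the Gaussian factor `2 * q +
      -- 3`.
      have h3 : M / v ^ (q + 1 + 1) - (2 * ((q + 1 : ℕ) : ℝ) + 1) * N (q + 1) =
          (M - (((2 * q + 1 : ℕ) : ℝ) + 2) * (v * M')) / v ^ (q + 2) +
            (2 * q + 3) * (M' / v ^ (q + 1) - N (q + 1)) := by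
        push_cast
        field_simp
        ring
      rw [h3]
      refine (abs_add_le _ _).trans ((add_le_add ?_ ?_).trans_eq (add_mul _ _ _).symm)
      · rw [abs_div, abs_of_pos (pow_pos hv0 _), div_le_iff₀ (pow_pos hv0 _)]
        calc _ ≤ K * (a * b ^ 2 * (b * (a * b) ^ q : ℕ)) := h1
          -- Power count: `a * b ^ 2 * b * (a * b) ^ q = (b / a) * (a * b) ^ (q + 2)`.
          _ = K / c ^ (q + 2) * (b / a) * (c * (a * b)) ^ (q + 2) := by
              push_cast
              field_simp
              ring
          _ ≤ _ := by gcongr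
      · rw [abs_mul, abs_of_nonneg (by positivity), mul_assoc]
        gcongr

end Moments
end Dissociated

/-! ### Moments of the standard normal distribution -/

lemma normalMoment_zero : normalMoment 0 = 1 := by
  simp [normalMoment]

lemma integrable_pow_mul_gaussianPDFReal (m : ℕ) :
    Integrable fun x : ℝ => x ^ m * gaussianPDFReal 0 1 x := by
  have h := (integrable_rpow_mul_exp_neg_mul_sq (b := 1 / 2) (by norm_num) (s := m)
    (by have := Nat.cast_nonneg (α := ℝ) m; linarith)).const_mul (Real.sqrt (2 * Real.pi))⁻¹
  refine h.congr (Filter.Eventually.of_forall fun x => ?_)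
  simp only [gaussianPDFReal, Real.rpow_natCast, NNReal.coe_one, mul_one, sub_zero]
  rw [show -(1 / 2) * x ^ 2 = -x ^ 2 / 2 by ring]
  ring

lemma normalMoment_eq_integral (m : ℕ) :
    normalMoment m = ∫ x : ℝ, x ^ m * gaussianPDFReal 0 1 x := by
  rw [normalMoment, integral_gaussianReal_eq_integral_smul (by norm_num)]
  simp [mul_comm]

lemma hasDerivAt_gaussianPDFReal (x : ℝ) :
    HasDerivAt (fun x => -gaussianPDFReal 0 1 x) (x * gaussianPDFReal 0 1 x) x := by
  have h1 : HasDerivAt (fun x : ℝ => -(x ^ 2 / 2)) (-x) x := by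
    convert! ((hasDerivAt_pow 2 x).div_const 2).neg using 1
    simp
  have h2 := (h1.exp.const_mul (Real.sqrt (2 * Real.pi))⁻¹).neg
  simp only [gaussianPDFReal, NNReal.coe_one, mul_one, sub_zero, neg_div]
  convert! h2 using 1
  ring

/-- Integration by parts, since minus the density is an antiderivative of `x` times the density. -/
lemma normalMoment_add_two (m : ℕ) : normalMoment (m + 2) = (m + 1) * normalMoment m := by
  have h := integral_mul_deriv_eq_deriv_mul_of_integrable (u := fun x : ℝ => x ^ (m + 1))
    (v := fun x => -gaussianPDFReal 0 1 x) (u' := fun x => (m + 1) * x ^ m)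
    (v' := fun x => x * gaussianPDFReal 0 1 x)
    (fun x _ => by simpa using hasDerivAt_pow (m + 1) x) (fun x _ => hasDerivAt_gaussianPDFReal x)
    ((integrable_pow_mul_gaussianPDFReal (m + 2)).congr
      (Filter.Eventually.of_forall fun x => by simp only [Pi.mul_apply]; ring))
    (((integrable_pow_mul_gaussianPDFReal m).const_mul (-(m + 1))).congr
      (Filter.Eventually.of_forall fun x => by simp only [Pi.mul_apply]; ring))
    ((integrable_pow_mul_gaussianPDFReal (m + 1)).neg.congr
      (Filter.Eventually.of_forall fun x => by simp only [Pi.mul_apply, Pi.neg_apply]; ring))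
  rw [normalMoment_eq_integral, normalMoment_eq_integral]
  calc _ = ∫ x : ℝ, x ^ (m + 1) * (x * gaussianPDFReal 0 1 x) := by
        congr 1; ext x; ring
    _ = ∫ x : ℝ, (m + 1) * (x ^ m * gaussianPDFReal 0 1 x) := by
        rw [h, ← integral_neg]
        congr 1; ext x; ring
    _ = _ := integral_const_mul _ _

/-! ### Edge indicators in the binomial random graph -/

namespace SimpleGraph

variable {V : Type} [Fintype V]

instance : MeasurableSingletonClass (SimpleGraph V) where
  measurableSet_singleton G := by
    rw [← measurableEmbedding_edgeSet.measurableSet_image, Set.image_singleton]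
    exact measurableSet_singleton _

lemma binomialRandom_real_subset [DecidableEq V] (p : unitInterval) (S : Finset (Sym2 V))
    (hS : ∀ e ∈ S, ¬ e.IsDiag) :
    (binomialRandom V p).real {G | (S : Set (Sym2 V)) ⊆ G.edgeSet} = (p : ℝ) ^ S.card := by
  -- `fromEdgeSet` discards the diagonal, which `S` avoids, so the event is a box for the product
  -- measure.
  have h1 : ((fun q : Sym2 V → Prop => {i | q i}) ⁻¹'
      (fromEdgeSet ⁻¹' {G : SimpleGraph V | (S : Set (Sym2 V)) ⊆ G.edgeSet})) =
      Set.pi S fun _ => {True} := by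
    ext q
    simp only [Set.mem_preimage, Set.mem_ofPred_eq, edgeSet_fromEdgeSet, Set.subset_def,
      Finset.mem_coe, Set.mem_sdiff, Set.mem_pi, Set.mem_singleton_iff, eq_iff_iff, iff_true]
    exact ⟨fun h e he => (h e he).1, fun h e he => ⟨h e he, by simpa using hS e he⟩⟩
  rw [measureReal_def, binomialRandom_eq_map,
    Measure.map_apply measurable_fromEdgeSet (Set.toFinite _).measurableSet,
    setBernoulli_apply', h1, Measure.infinitePi_pi _ fun _ _ => MeasurableSet.of_discrete,
    Finset.prod_congr rfl (g := fun _ => (unitInterval.toNNReal p : ENNReal)), Finset.prod_const]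
  · simp
  · intro e he
    simp [hS e he]

/-- The expectation with respect to the binomial random graph, as a linear functional. -/
noncomputable def expectation (V : Type) [Fintype V] (p : unitInterval) :
    (SimpleGraph V → ℝ) →ₗ[ℝ] ℝ where
  toFun f := ∫ G, f G ∂(binomialRandom V p)
  map_add' _ _ := integral_add (Integrable.of_finite) (Integrable.of_finite)
  map_smul' _ _ := integral_const_mul _ _

lemma expectation_apply (p : unitInterval) (f : SimpleGraph V → ℝ) :
    expectation V p f = ∫ G, f G ∂(binomialRandom V p) := rfl

/-- The indicator that `G` contains all edges from `S`. -/
noncomputable def containsEdges (S : Finset (Sym2 V)) : SimpleGraph V → ℝ :=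
  Set.indicator {G | (S : Set (Sym2 V)) ⊆ G.edgeSet} 1

lemma expectation_containsEdges [DecidableEq V] (p : unitInterval) {S : Finset (Sym2 V)}
    (hS : ∀ e ∈ S, ¬ e.IsDiag) : expectation V p (containsEdges S) = (p : ℝ) ^ S.card := by
  rw [← binomialRandom_real_subset p S hS, expectation_apply, containsEdges,
    integral_indicator_one (Set.toFinite _).measurableSet]

omit [Fintype V] in
lemma containsEdges_union [DecidableEq V] (S T : Finset (Sym2 V)) (G : SimpleGraph V) :
    containsEdges (S ∪ T) G = containsEdges S G * containsEdges T G := by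
  classical
  simp only [containsEdges, Set.indicator_apply, Set.mem_ofPred_eq, Finset.coe_union,
    Set.union_subset_iff, Pi.one_apply]
  split_ifs <;> simp_all

omit [Fintype V] in
lemma prod_containsEdges [DecidableEq V] {ι : Type} (F : ι → Finset (Sym2 V)) (T : Finset ι)
    (G : SimpleGraph V) : ∏ i ∈ T, containsEdges (F i) G = containsEdges (T.biUnion F) G := by
  classical
  induction T using Finset.induction_on with
  | empty => simp [containsEdges]
  | insert i T hi ih => rw [Finset.prod_insert hi, ih, Finset.biUnion_insert, containsEdges_union]

omit [Fintype V] in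
lemma containsEdges_mem (S : Finset (Sym2 V)) (G : SimpleGraph V) :
    0 ≤ containsEdges S G ∧ containsEdges S G ≤ 1 := by
  classical
  simp only [containsEdges, Set.indicator_apply]
  split_ifs <;> simp

/-- The centred indicators that `G` contains given edge sets are a dissociated family. -/
lemma isDissociated_containsEdges [DecidableEq V] (p : unitInterval) {𝒜 : Type}
    (E : 𝒜 → Finset (Sym2 V)) (hE : ∀ α, ∀ e ∈ E α, ¬ e.IsDiag) :
    Dissociated.IsDissociated (expectation V p)
      (fun α G => containsEdges (E α) G - (p : ℝ) ^ (E α).card) E where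
  one := by simp [expectation_apply]
  centred α := by
    have h : (fun G => containsEdges (E α) G - (p : ℝ) ^ (E α).card) =
        containsEdges (E α) - ((p : ℝ) ^ (E α).card) • 1 := by
      ext G
      simp
    rw [h, map_sub, map_smul, expectation_containsEdges p (hE α)]
    simp [expectation_apply]
  abs_le_one {ι} f T := by
    rw [expectation_apply, ← Real.norm_eq_abs]
    refine (norm_integral_le_of_norm_le_const (C := 1)
      (Filter.Eventually.of_forall fun G => ?_)).trans (by simp)
    rw [Real.norm_eq_abs, Finset.abs_prod]
    refine Finset.prod_le_one (fun _ _ => abs_nonneg _) fun i _ => ?_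
    have h1 := containsEdges_mem (E (f i)) G
    have h2 : (p : ℝ) ^ (E (f i)).card ≤ 1 := pow_le_one₀ p.2.1 p.2.2
    have h3 : 0 ≤ (p : ℝ) ^ (E (f i)).card := pow_nonneg p.2.1 _
    rw [abs_le]
    constructor <;> linarith
  mul {ι} f T U hd := by
    classical
    have hB : ∀ R : Finset ι, ∀ e ∈ R.biUnion fun i => E (f i), ¬ e.IsDiag := fun R e he => by
      obtain ⟨i, _, hi⟩ := Finset.mem_biUnion.1 he
      exact hE _ e hi
    -- Expanding the centred products leaves indicators of unions of edge sets, for which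
    -- independence is additivity of exponents of `p` over disjoint unions.
    have hexp : ∀ (R : Finset ι) (G : SimpleGraph V),
        ∏ i ∈ R, (containsEdges (E (f i)) G - (p : ℝ) ^ (E (f i)).card) =
          ∑ R' ∈ R.powerset, (∏ i ∈ R \ R', -(p : ℝ) ^ (E (f i)).card) *
            containsEdges (R'.biUnion fun i => E (f i)) G := fun R G => by
      simp_rw [sub_eq_add_neg, Finset.prod_add, prod_containsEdges, mul_comm]
    have hsum : ∀ (s : Finset (Finset ι)) (g : Finset ι → SimpleGraph V → ℝ),
        expectation V p (fun G => ∑ R ∈ s, g R G) = ∑ R ∈ s, expectation V p (g R) :=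
      fun s g => by
        rw [← map_sum]
        congr 1
        ext G
        simp
    have hmul : ∀ (c : ℝ) (g : SimpleGraph V → ℝ),
        expectation V p (fun G => c * g G) = c * expectation V p g := fun c g =>
      (expectation V p).map_smul c g
    simp_rw [hexp, Finset.sum_mul_sum, hsum, hmul, Finset.sum_mul_sum]
    refine Finset.sum_congr rfl fun R hR => Finset.sum_congr rfl fun R' hR' => ?_
    have hdisj : Disjoint (R.biUnion fun i => E (f i)) (R'.biUnion fun i => E (f i)) := by
      simp only [Finset.disjoint_biUnion_left, Finset.disjoint_biUnion_right]
      exact fun j hj i hi => hd i (Finset.mem_powerset.1 hR hi) j (Finset.mem_powerset.1 hR' hj)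
    have hprod : ∀ (c c' : ℝ) (S S' : Finset (Sym2 V)),
        expectation V p (fun G => c * containsEdges S G * (c' * containsEdges S' G)) =
          c * c' * expectation V p (containsEdges (S ∪ S')) := fun c c' S S' => by
      rw [← hmul]
      congr 1
      ext G
      rw [mul_mul_mul_comm, containsEdges_union]
    rw [hprod, mul_mul_mul_comm]
    rw [expectation_containsEdges p (hB R), expectation_containsEdges p (hB R'), ← pow_add,
      ← Finset.card_union_of_disjoint hdisj]
    congr 1
    refine expectation_containsEdges p fun e he => ?_
    rcases Finset.mem_union.1 he with he | he
    exacts [hB R e he, hB R' e he]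

end SimpleGraph

/-! ### Lower bound for the variance -/

/-- Cauchy–Schwarz for the degrees of the elements `e`: their sum counts incidences, and the sum of
their squares counts pairwise overlaps. -/
lemma sq_sum_card_le {𝒜 ε : Type} [Fintype 𝒜] [Fintype ε] [DecidableEq ε] (E : 𝒜 → Finset ε) :
    (∑ α, (E α).card) ^ 2 ≤ Fintype.card ε * ∑ α, ∑ β, (E α ∩ E β).card := by
  have h1 : ∑ α, (E α).card = ∑ e, ∑ α, if e ∈ E α then 1 else 0 := by
    rw [Finset.sum_comm]
    simp
  have h2 : ∑ α, ∑ β, (E α ∩ E β).card = ∑ e, (∑ α, if e ∈ E α then 1 else 0) ^ 2 := by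
    simp_rw [sq, Finset.sum_mul_sum]
    rw [Finset.sum_comm' (t' := Finset.univ) (s' := fun _ => Finset.univ) (by simp)]
    simp_rw [Finset.sum_comm (s := (Finset.univ : Finset ε))]
    simp [← ite_and, ← Finset.mem_inter, Finset.inter_comm]
  rw [h1, h2, ← Finset.card_univ]
  exact sq_sum_le_card_mul_sum_sq

/-- Bounds the covariance of two copies sharing `t` edges below by a linear function of `t`, the
form in which overlaps can be summed. -/
lemma le_pow_sub_sub_pow {p : ℝ} (hp0 : 0 < p) (hp1 : p < 1) {k t : ℕ} (ht : t ≤ k) :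
    p ^ (2 * k) * (1 - p) * t ≤ k * (p ^ (2 * k - t) - p ^ (2 * k)) := by
  rcases Nat.eq_zero_or_pos t with rfl | ht0
  · simp
  have h1 : p ^ (2 * k - 1) ≤ p ^ (2 * k - t) :=
    pow_le_pow_of_le_one hp0.le hp1.le (by omega)
  have h2 : p ^ (2 * k) = p ^ (2 * k - 1) * p := by
    rw [← pow_succ]
    congr 1
    omega
  have h3 : p ^ (2 * k) ≤ p ^ (2 * k - 1) := pow_le_pow_of_le_one hp0.le hp1.le (by omega)
  have h4 : 0 ≤ 1 - p := by linarith
  have h5 : 0 < p ^ (2 * k) := pow_pos hp0 _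
  have h6 : (t : ℝ) ≤ k := Nat.cast_le.2 ht
  calc p ^ (2 * k) * (1 - p) * t ≤ p ^ (2 * k - 1) * (1 - p) * k := by gcongr
    _ = k * (p ^ (2 * k - 1) - p ^ (2 * k)) := by rw [h2]; ring
    _ ≤ _ := by gcongr

namespace SimpleGraph

variable {V : Type} [Fintype V] [DecidableEq V] {p : unitInterval} {𝒜 : Type} [Fintype 𝒜]
  {E : 𝒜 → Finset (Sym2 V)} {k : ℕ}

/-- The centred indicator that a random graph contains the edges from `E α`. -/
noncomputable def centredContains (p : unitInterval) (E : 𝒜 → Finset (Sym2 V)) (α : 𝒜)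
    (G : SimpleGraph V) : ℝ :=
  containsEdges (E α) G - (p : ℝ) ^ (E α).card

lemma le_sumMoment_two (hp0 : 0 < (p : ℝ)) (hp1 : (p : ℝ) < 1)
    (hE : ∀ α, ∀ e ∈ E α, ¬ e.IsDiag) (hk : ∀ α, (E α).card = k) :
    (p : ℝ) ^ (2 * k) * (1 - p) * (k * Fintype.card 𝒜 ^ 2) ≤
      Fintype.card (Sym2 V) *
        Dissociated.sumMoment (expectation V p) (centredContains p E) 2 := by
  have hcov : ∀ α β, expectation V p (fun G => centredContains p E α G * centredContains p E β G) =
      (p : ℝ) ^ (2 * k - (E α ∩ E β).card) - (p : ℝ) ^ (2 * k) := fun α β => by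
    have h1 : (fun G => centredContains p E α G * centredContains p E β G) =
        containsEdges (E α ∪ E β) - (p : ℝ) ^ k • containsEdges (E α)
          - (p : ℝ) ^ k • containsEdges (E β) + (p : ℝ) ^ (2 * k) • 1 := by
      ext G
      simp only [centredContains, hk, Pi.add_apply, Pi.sub_apply, Pi.smul_apply, smul_eq_mul,
        containsEdges_union, Pi.one_apply]
      ring
    have h2 : (E α ∪ E β).card = 2 * k - (E α ∩ E β).card := by
      have := Finset.card_union_add_card_inter (E α) (E β)
      rw [hk, hk] at this
      omega
    have h3 : expectation V p 1 = 1 := (isDissociated_containsEdges p E hE).one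
    rw [h1]
    simp only [map_add, map_sub, map_smul, smul_eq_mul, h3]
    rw [expectation_containsEdges p (hE α), expectation_containsEdges p (hE β),
      expectation_containsEdges p, hk, hk, h2]
    · ring
    · intro e he
      rcases Finset.mem_union.1 he with he | he
      exacts [hE α e he, hE β e he]
  have hmom : Dissociated.sumMoment (expectation V p) (centredContains p E) 2 =
      ∑ α, ∑ β, ((p : ℝ) ^ (2 * k - (E α ∩ E β).card) - (p : ℝ) ^ (2 * k)) := by
    simp_rw [← hcov, ← map_sum, Dissociated.sumMoment]
    congr 1
    ext G
    simp [sq, Finset.sum_mul_sum]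
  have h1 : (p : ℝ) ^ (2 * k) * (1 - p) * ∑ α, ∑ β, ((E α ∩ E β).card : ℝ) ≤
      k * Dissociated.sumMoment (expectation V p) (centredContains p E) 2 := by
    simp_rw [hmom, Finset.mul_sum]
    exact Finset.sum_le_sum fun α _ => Finset.sum_le_sum fun β _ => le_pow_sub_sub_pow hp0 hp1
      ((Finset.card_le_card Finset.inter_subset_left).trans_eq (hk α))
  have h2 : ((k * Fintype.card 𝒜 : ℕ) : ℝ) ^ 2 ≤
      Fintype.card (Sym2 V) * ∑ α, ∑ β, ((E α ∩ E β).card : ℝ) := by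
    have := sq_sum_card_le E
    simp only [hk, Finset.sum_const, Finset.card_univ, smul_eq_mul] at this
    rw [mul_comm k]
    exact_mod_cast this
  rcases Nat.eq_zero_or_pos k with rfl | hk0
  · have h0 : 0 ≤ Dissociated.sumMoment (expectation V p) (centredContains p E) 2 := by
      rw [Dissociated.sumMoment, expectation_apply]
      exact integral_nonneg fun G => sq_nonneg _
    simpa using mul_nonneg (Nat.cast_nonneg _) h0
  have hk' : (0 : ℝ) < k := Nat.cast_pos.2 hk0
  have h4 : 0 ≤ 1 - (p : ℝ) := by linarith
  refine le_of_mul_le_mul_left ?_ hk'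
  calc (k : ℝ) * ((p : ℝ) ^ (2 * k) * (1 - p) * (k * Fintype.card 𝒜 ^ 2))
      = (p : ℝ) ^ (2 * k) * (1 - p) * ((k * Fintype.card 𝒜 : ℕ) : ℝ) ^ 2 := by
        push_cast
        ring
    _ ≤ (p : ℝ) ^ (2 * k) * (1 - p) *
          (Fintype.card (Sym2 V) * ∑ α, ∑ β, ((E α ∩ E β).card : ℝ)) := by gcongr
    _ = Fintype.card (Sym2 V) *
          ((p : ℝ) ^ (2 * k) * (1 - p) * ∑ α, ∑ β, ((E α ∩ E β).card : ℝ)) := by ring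
    _ ≤ Fintype.card (Sym2 V) *
          (k * Dissociated.sumMoment (expectation V p) (centredContains p E) 2) := by gcongr
    _ = _ := by ring

lemma sub_integral_eq_sum_centredContains (hE : ∀ α, ∀ e ∈ E α, ¬ e.IsDiag)
    {Y : SimpleGraph V → ℝ} (hY : ∀ G, Y G = ∑ α, containsEdges (E α) G) (G : SimpleGraph V) :
    Y G - ∫ G', Y G' ∂(binomialRandom V p) = ∑ α, centredContains p E α G := by
  have h1 : Y = ∑ α, containsEdges (E α) := by
    ext G
    simp [hY]
  rw [← expectation_apply, h1, map_sum, Finset.sum_apply]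
  simp only [centredContains, Finset.sum_sub_distrib]
  congr 1
  exact Finset.sum_congr rfl fun α _ => expectation_containsEdges p (hE α)

lemma variance_eq_sumMoment (hE : ∀ α, ∀ e ∈ E α, ¬ e.IsDiag)
    {Y : SimpleGraph V → ℝ} (hY : ∀ G, Y G = ∑ α, containsEdges (E α) G) :
    variance Y (binomialRandom V p) =
      Dissociated.sumMoment (expectation V p) (centredContains p E) 2 := by
  rw [variance_eq_integral (Measurable.of_discrete).aemeasurable, Dissociated.sumMoment,
    expectation_apply]
  simp_rw [sub_integral_eq_sum_centredContains hE hY]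

lemma integral_standardised_pow (hE : ∀ α, ∀ e ∈ E α, ¬ e.IsDiag)
    {Y : SimpleGraph V → ℝ} (hY : ∀ G, Y G = ∑ α, containsEdges (E α) G) (q : ℕ) :
    ∫ G, standardised (binomialRandom V p) Y G ^ (2 * q) ∂(binomialRandom V p) =
      Dissociated.sumMoment (expectation V p) (centredContains p E) (2 * q) /
        Dissociated.sumMoment (expectation V p) (centredContains p E) 2 ^ q := by
  simp_rw [standardised, sub_integral_eq_sum_centredContains hE hY, div_pow, integral_div]
  rw [pow_mul (Real.sqrt _), Real.sq_sqrt (variance_nonneg _ _), variance_eq_sumMoment hE hY]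
  rfl

end SimpleGraph

/-! ### Copies of `H` in the complete graph -/

namespace SimpleGraph

variable {V : Type*} (H : SimpleGraph V) (n : ℕ)

/-- The copies of `H` in the complete graph on `Fin n`. -/
abbrev Placement : Type :=
  {A : (⊤ : SimpleGraph (Fin n)).Subgraph // Nonempty (H ≃g A.coe)}

noncomputable instance : Fintype (Placement H n) := Fintype.ofFinite _

variable {H n}

open Classical in
/-- The edges of a copy of `H`. -/
noncomputable def Placement.edges (A : Placement H n) : Finset (Sym2 (Fin n)) :=
  A.1.edgeSet.toFinset

@[simp] lemma Placement.coe_edges (A : Placement H n) :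
    (A.edges : Set (Sym2 (Fin n))) = A.1.edgeSet := by
  simp [Placement.edges]

lemma Placement.mem_edges {A : Placement H n} {e : Sym2 (Fin n)} :
    e ∈ A.edges ↔ e ∈ A.1.edgeSet := by
  simp [Placement.edges]

lemma Placement.not_isDiag_of_mem_edges (A : Placement H n) : ∀ e ∈ A.edges, ¬ e.IsDiag := by
  intro e he
  exact not_isDiag_of_mem_edgeSet _ (A.1.edgeSet_subset (Placement.mem_edges.1 he))

lemma Placement.card_edges (A : Placement H n) : A.edges.card = H.edgeSet.ncard := by
  obtain ⟨φ⟩ := A.2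
  rw [← Set.ncard_coe_finset, A.coe_edges, ← Subgraph.image_coe_edgeSet_coe,
    Set.ncard_image_of_injective _ (Sym2.map.injective Subtype.coe_injective),
    ← Nat.card_coe_set_eq, ← Nat.card_coe_set_eq]
  exact (Nat.card_congr φ.mapEdgeSet).symm

/-- A copy in `G` is a copy in the complete graph whose edges lie in `G`. If `H` has isolated
vertices, distinct copies may share the same edge set, so the sum runs over copies. -/
lemma subgraphCount_eq_sum (G : SimpleGraph (Fin n)) :
    subgraphCount H n G = ∑ A : Placement H n, containsEdges A.edges G := by
  classical
  have h1 : ∀ A : Placement H n,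
      containsEdges A.edges G = if A.1.edgeSet ⊆ G.edgeSet then 1 else 0 := fun A => by
    simp [containsEdges, Set.indicator_apply]
  simp_rw [h1, Finset.sum_boole, subgraphCount, copyCount]
  congr 1
  have hadj : ∀ {A : (⊤ : SimpleGraph (Fin n)).Subgraph} {x y}, A.edgeSet ⊆ G.edgeSet →
      A.Adj x y → G.Adj x y := fun {A x y} h hA => h (a := s(x, y)) hA
  refine Finset.card_bij'
    (fun B hB => ⟨⟨B.verts, B.Adj, fun h => (B.adj_sub h).ne, B.edge_vert, B.symm⟩,
      (Finset.mem_filter.1 hB).2⟩)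
    (fun A hA => ⟨A.1.verts, A.1.Adj, hadj (Finset.mem_filter.1 hA).2, A.1.edge_vert, A.1.symm⟩)
    ?_ ?_ ?_ ?_
  · intro B hB
    simp only [Finset.mem_filter, Finset.mem_univ, true_and]
    rintro ⟨x, y⟩ h
    exact B.adj_sub h
  · intro A hA
    simp only [Finset.mem_filter, Finset.mem_univ, true_and]
    exact A.2
  · intro B hB
    rfl
  · intro A hA
    rfl

/-- The vertex of a copy of `H` that corresponds to a given vertex of `H`. -/
noncomputable def Placement.vertex (A : Placement H n) (v : V) : Fin n :=
  A.2.some v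

lemma Placement.adj_iff (A : Placement H n) (x y : Fin n) :
    A.1.Adj x y ↔ ∃ u v, H.Adj u v ∧ A.vertex u = x ∧ A.vertex v = y := by
  constructor
  · intro h
    have hx := A.1.edge_vert h
    have hy := A.1.edge_vert h.symm
    refine ⟨A.2.some.symm ⟨x, hx⟩, A.2.some.symm ⟨y, hy⟩, ?_, ?_, ?_⟩
    · rw [A.2.some.symm.map_adj_iff]
      exact h
    · simp [Placement.vertex]
    · simp [Placement.vertex]
  · rintro ⟨u, v, h, rfl, rfl⟩
    exact A.2.some.map_adj_iff.2 h

lemma Placement.verts_eq (A : Placement H n) : A.1.verts = Set.range A.vertex := by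
  ext x
  constructor
  · intro hx
    exact ⟨A.2.some.symm ⟨x, hx⟩, by simp [Placement.vertex]⟩
  · rintro ⟨v, rfl⟩
    exact (A.2.some v).2

lemma Placement.vertex_injective :
    Function.Injective (Placement.vertex : Placement H n → V → Fin n) := by
  intro A B hAB
  refine Subtype.ext (Subgraph.ext ?_ ?_)
  · rw [A.verts_eq, B.verts_eq, hAB]
  · ext x y
    rw [A.adj_iff, B.adj_iff, hAB]

variable [Fintype V]

lemma Placement.card_le : Fintype.card (Placement H n) ≤ n ^ Fintype.card V := by
  classical
  have := Fintype.card_le_of_injective _ (Placement.vertex_injective (H := H) (n := n))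
  simpa using this

lemma card_filter_apply_eq_apply_eq_le [DecidableEq V] {u v : V} (huv : u ≠ v) (x y : Fin n) :
    (Finset.univ.filter fun f : V → Fin n => f u = x ∧ f v = y).card ≤
      n ^ (Fintype.card V - 2) := by
  have h1 : ∀ z : Fin n, (Finset.univ.filter fun w => w = z).card ≤ 1 := fun z => by
    rw [Finset.filter_eq' Finset.univ z, if_pos (Finset.mem_univ z), Finset.card_singleton]
  have h2 : (Finset.univ.filter fun g : {w // w ≠ u} → Fin n =>
      g ⟨v, huv.symm⟩ = y).card ≤ 1 * n ^ (Fintype.card V - 2) := by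
    refine Dissociated.card_filter_le_mul (⟨v, huv.symm⟩ : {w // w ≠ u}) _ (fun z => z = y)
      (fun _ _ => True) (fun f hf => ⟨hf, trivial⟩) (h1 y) fun _ _ => ?_
    refine (Finset.card_le_univ _).trans_eq ?_
    rw [Fintype.card_fun, Fintype.card_fin, Fintype.card_subtype_compl, Fintype.card_subtype_eq,
      Fintype.card_subtype_compl, Fintype.card_subtype_eq, Nat.sub_sub]
  exact (Dissociated.card_filter_le_mul u _ (fun z => z = x) (fun _ g => g ⟨v, huv.symm⟩ = y)
    (fun f hf => hf) (h1 x) fun _ _ => h2).trans_eq (by rw [one_mul, one_mul])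

open Classical in
lemma Placement.card_filter_mem_edges_le (e : Sym2 (Fin n)) :
    (Finset.univ.filter fun A : Placement H n => e ∈ A.edges).card ≤
      Fintype.card V ^ 2 * n ^ (Fintype.card V - 2) := by
  induction e with | _ x y
  set F : V × V → Finset (V → Fin n) := fun w =>
    if w.1 = w.2 then ∅ else Finset.univ.filter fun f => f w.1 = x ∧ f w.2 = y
  calc _ ≤ (Finset.univ.biUnion F).card := by
        refine Finset.card_le_card_of_injOn Placement.vertex ?_ Placement.vertex_injective.injOn
        intro A hA
        obtain ⟨u, v, h, hu, hv⟩ := (A.adj_iff x y).1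
          (Placement.mem_edges.1 (Finset.mem_filter.1 hA).2)
        simp only [Finset.coe_biUnion, Set.mem_iUnion, Finset.mem_coe]
        exact ⟨(u, v), Finset.mem_univ _, by simp [F, h.ne, hu, hv]⟩
    _ ≤ (Finset.univ : Finset (V × V)).card * n ^ (Fintype.card V - 2) := by
        refine Finset.card_biUnion_le_card_mul _ _ _ fun w _ => ?_
        simp only [F]
        split_ifs with hw
        · simp
        · exact card_filter_apply_eq_apply_eq_le hw x y
    _ = _ := by rw [Finset.card_univ, Fintype.card_prod, sq]

/-- The bound on the number of copies is inflated by the square of `Fintype.card V`, so that the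
ratio of the two bounds is exactly `n⁻²`. -/
lemma Placement.sparseFamily (hn : Fintype.card V ≤ n) (hV : 2 ≤ Fintype.card V) :
    Dissociated.SparseFamily (Placement.edges (H := H) (n := n)) H.edgeSet.ncard
      (Fintype.card V ^ 2 * n ^ Fintype.card V)
      (Fintype.card V ^ 2 * n ^ (Fintype.card V - 2)) where
  card_le A := A.card_edges.le
  card_univ_le := Placement.card_le.trans (Nat.le_mul_of_pos_left _ (by positivity))
  degree_le e := by convert! Placement.card_filter_mem_edges_le e
  le := Nat.mul_le_mul_left _ (Nat.pow_le_pow_right (by omega) (by omega))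

omit [Fintype V] in
lemma exists_subgraph_verts_eq {G : SimpleGraph (Fin n)} {s : Finset (Fin n)} (e : V ≃ s)
    (h : ∀ u v, H.Adj u v → G.Adj (e u) (e v)) :
    ∃ A : G.Subgraph, Nonempty (H ≃g A.coe) ∧ A.verts = s := by
  let f : Copy H G := ⟨⟨fun v => e v, fun {u v} => h u v⟩, fun u v h => by
    simpa [Subtype.ext_iff] using h⟩
  refine ⟨f.toSubgraph, ⟨f.isoToSubgraph⟩, ?_⟩
  ext x
  simp only [Copy.toSubgraph, Subgraph.map_verts, Subgraph.verts_top, Set.image_univ, Set.mem_range,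
    Finset.mem_coe]
  constructor
  · rintro ⟨v, rfl⟩
    exact (e v).2
  · intro hx
    exact ⟨e.symm ⟨x, hx⟩, by simp [f]⟩

lemma exists_placement {s : Finset (Fin n)} (hs : s.card = Fintype.card V) :
    ∃ A : Placement H n, A.1.verts = s := by
  obtain ⟨A, hA, hAs⟩ := exists_subgraph_verts_eq (H := H) (G := ⊤)
    (Fintype.equivOfCardEq (by simp [hs]) : V ≃ s)
    fun u v h => by simpa [Subtype.ext_iff] using h.ne
  exact ⟨⟨A, hA⟩, hAs⟩

lemma choose_le_card_placement : n.choose (Fintype.card V) ≤ Fintype.card (Placement H n) := by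
  classical
  choose A hA using fun s : {s : Finset (Fin n) // s.card = Fintype.card V} =>
    exists_placement (H := H) s.2
  have hinj : Function.Injective A := fun s t hst => by
    refine Subtype.ext (Finset.coe_injective ?_)
    rw [← hA, ← hA, hst]
  have h := Fintype.card_le_of_injective A hinj
  rwa [Fintype.card_finset_len, Fintype.card_fin] at h

/-- Each `l`-set of vertices carries a copy, and `n ≤ l * (n + 1 - l)` makes the falling factorial
comparable to `n ^ l`. -/
lemma pow_le_mul_card_placement (hn : Fintype.card V ≤ n) :
    n ^ Fintype.card V ≤ Fintype.card V ^ Fintype.card V * (Fintype.card V).factorial *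
      Fintype.card (Placement H n) := by
  set l := Fintype.card V
  rcases Nat.eq_zero_or_pos l with hl | hl
  · have := choose_le_card_placement (H := H) (n := n)
    simp only [hl, pow_zero, Nat.factorial_zero, one_mul]
    have h0 : Fintype.card V = 0 := hl
    rwa [h0, Nat.choose_zero_right] at this
  · have h1 : n ≤ l * (n + 1 - l) := by
      obtain ⟨d, rfl⟩ := Nat.exists_eq_add_of_le hn
      rw [show l + d + 1 - l = d + 1 by omega]
      nlinarith
    calc n ^ l ≤ (l * (n + 1 - l)) ^ l := Nat.pow_le_pow_left h1 _
      _ = l ^ l * (n + 1 - l) ^ l := mul_pow _ _ _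
      _ ≤ l ^ l * (l.factorial * n.choose l) := by
          refine Nat.mul_le_mul_left _ ?_
          exact (Nat.pow_sub_le_descFactorial n l).trans_eq
            (Nat.descFactorial_eq_factorial_mul_choose n l)
      _ ≤ l ^ l * (l.factorial * Fintype.card (Placement H n)) := by
          gcongr
          exact choose_le_card_placement
      _ = _ := by ring

end SimpleGraph

/-! ### Triangles, and assembly of the bound -/

namespace SimpleGraph

/-- All vertices of a copy of the complete graph are adjacent in it, so the copy is determined by
its vertex set. -/
lemma triangleCount_eq_subgraphCount (n : ℕ) :
    triangleCount n = subgraphCount (⊤ : SimpleGraph (Fin 3)) n := by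
  classical
  ext G
  rw [triangleCount, subgraphCount, copyCount]
  have h0 : {s : Finset (Fin n) | G.IsNClique 3 s} =
      (Finset.univ.filter fun s : Finset (Fin n) => G.IsNClique 3 s : Finset (Finset (Fin n))) := by
    ext s
    simp
  have hadj : ∀ A : G.Subgraph, Nonempty ((⊤ : SimpleGraph (Fin 3)) ≃g A.coe) →
      ∀ x ∈ A.verts, ∀ y ∈ A.verts, x ≠ y → A.Adj x y := by
    rintro A ⟨φ⟩ x hx y hy hxy
    have h : A.coe.Adj (φ (φ.symm ⟨x, hx⟩)) (φ (φ.symm ⟨y, hy⟩)) := by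
      rw [φ.map_adj_iff, top_adj]
      simpa using hxy
    simpa using h
  rw [h0, Set.ncard_coe_finset]
  congr 1
  symm
  refine Finset.card_bij (fun A _ => A.verts.toFinset) ?_ ?_ ?_
  · intro A hA
    have hφ := (Finset.mem_filter.1 hA).2
    refine Finset.mem_filter.2 ⟨Finset.mem_univ _, ?_, ?_⟩
    · intro x hx y hy hxy
      exact A.adj_sub (hadj A hφ x (by simpa using hx) y (by simpa using hy) hxy)
    · obtain ⟨φ⟩ := hφ
      rw [Set.toFinset_card, ← Fintype.card_congr φ.toEquiv, Fintype.card_fin]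
  · intro A hA B hB hAB
    have hv : A.verts = B.verts := by simpa using hAB
    refine Subgraph.ext hv ?_
    ext x y
    constructor
    · intro h
      exact hadj B (Finset.mem_filter.1 hB).2 x (hv ▸ A.edge_vert h) y
        (hv ▸ A.edge_vert h.symm) h.ne
    · intro h
      exact hadj A (Finset.mem_filter.1 hA).2 x (hv ▸ B.edge_vert h) y
        (hv ▸ B.edge_vert h.symm) h.ne
  · intro s hs
    obtain ⟨hclique, hcard⟩ := (Finset.mem_filter.1 hs).2
    have e : Fin 3 ≃ s := Fintype.equivOfCardEq (by simp [hcard])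
    obtain ⟨A, hA, hAs⟩ := exists_subgraph_verts_eq (H := (⊤ : SimpleGraph (Fin 3))) (G := G) e
      fun u v h => hclique (e u).2 (e v).2 fun huv => h.ne (e.injective (Subtype.ext huv))
    refine ⟨A, ?_, ?_⟩
    · rw [Finset.mem_filter]
      exact ⟨@Finset.mem_univ _ (_) _, hA⟩
    · exact Finset.coe_injective (by rw [Set.coe_toFinset, hAs])

/-- The normalised even moments of the number of copies of a fixed graph in the binomial random
graph approach those of the normal distribution with rate `n⁻²`. -/
theorem exists_subgraphCount_moment_bound (p : unitInterval) (hp0 : 0 < (p : ℝ))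
    (hp1 : (p : ℝ) < 1) {m : ℕ} (hm : Even m) {k : ℕ} (l : ℕ) (hk : 1 ≤ k) :
    ∃ C : ℝ, ∀ (V : Type*) [Fintype V] (H : SimpleGraph V),
      H.edgeSet.ncard = k → Fintype.card V = l → ∀ n : ℕ, l ≤ n →
        0 < variance (subgraphCount H n) (binomialRandom (Fin n) p) ∧
        |(∫ G, standardised (binomialRandom (Fin n) p) (subgraphCount H n) G ^ m
            ∂(binomialRandom (Fin n) p)) - normalMoment m| ≤ C / (n : ℝ) ^ 2 := by
  rcases Nat.eq_zero_or_pos l with rfl | hl0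
  · refine ⟨0, fun V _ H hHk hV => ?_⟩
    have := Fintype.card_eq_zero_iff.1 hV
    rw [Set.eq_empty_of_isEmpty H.edgeSet, Set.ncard_empty] at hHk
    omega
  obtain ⟨q, rfl⟩ := even_iff_exists_two_mul.1 hm
  have h1p : 0 < 1 - (p : ℝ) := by linarith
  set D : ℝ := (l : ℝ) ^ l * l.factorial with hD
  have hl : (0 : ℝ) < l := Nat.cast_pos.2 hl0
  have hD0 : 0 < D := by positivity
  -- `l ^ 4` cancels the two factors `l ^ 2` in `a * b`; `D ^ 2` comes from squaring the lower bound
  -- `n ^ l / D` for the number of copies.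
  set c : ℝ := (p : ℝ) ^ (2 * k) * (1 - p) / (l ^ 4 * D ^ 2) with hc
  have hc0 : 0 < c := by positivity
  obtain ⟨C, hC⟩ := Dissociated.exists_abs_sumMoment_div_sub_le (N := fun q => normalMoment (2 * q))
    normalMoment_zero (fun q => by
      rw [show 2 * (q + 1) = 2 * q + 2 by ring, normalMoment_add_two]
      push_cast
      ring) k hc0 q
  refine ⟨C, fun V _ H hHk hV n hn => ?_⟩
  -- An edge has two distinct ends; this keeps the subtraction in `n ^ (l - 2)` from truncating.
  have hl2 : 2 ≤ l := by
    obtain ⟨e, he⟩ := Set.nonempty_of_ncard_ne_zero (show H.edgeSet.ncard ≠ 0 by omega)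
    induction e with | _ x y
    have : Nontrivial V := ⟨x, y, (show H.Adj x y from he).ne⟩
    rw [← hV]
    exact Fintype.one_lt_card
  have hn0 : 0 < n := by omega
  have hn' : (0 : ℝ) < n := Nat.cast_pos.2 hn0
  have hdiag := fun A : Placement H n => A.not_isDiag_of_mem_edges
  have hdis := isDissociated_containsEdges p Placement.edges hdiag
  have hsparse := Placement.sparseFamily (H := H) (hV.trans_le hn) (hl2.trans_eq hV.symm)
  rw [hV, hHk] at hsparse
  have hpow : (n : ℝ) ^ l = n ^ (l - 2) * n ^ 2 := by
    rw [← pow_add]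
    congr 1
    omega
  have hvar : c * (((l ^ 2 * n ^ l : ℕ) : ℝ) * ((l ^ 2 * n ^ (l - 2) : ℕ) : ℝ)) ≤
      Dissociated.sumMoment (expectation (Fin n) p) (centredContains p (Placement.edges (H := H)))
        2 := by
    have h1 := le_sumMoment_two hp0 hp1 hdiag fun A => A.card_edges.trans hHk
    have h2 : (Fintype.card (Sym2 (Fin n)) : ℝ) ≤ n ^ 2 := by
      have := Fintype.card_le_of_surjective _ (Sym2.mk_surjective (α := Fin n))
      rw [Fintype.card_prod, Fintype.card_fin] at this
      rw [sq]
      exact_mod_cast this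
    have h3 : (n : ℝ) ^ l ≤ D * Fintype.card (Placement H n) := by
      have := pow_le_mul_card_placement (H := H) (hV.trans_le hn)
      rw [hV] at this
      rw [hD]
      exact_mod_cast this
    have h4 : 0 ≤ Dissociated.sumMoment (expectation (Fin n) p)
        (centredContains p (Placement.edges (H := H))) 2 := by
      rw [Dissociated.sumMoment, expectation_apply]
      exact integral_nonneg fun G => sq_nonneg _
    have hk' : (1 : ℝ) ≤ k := Nat.one_le_cast.2 hk
    refine le_of_mul_le_mul_left ?_ (pow_pos hn' 2)
    calc (n : ℝ) ^ 2 * (c * (((l ^ 2 * n ^ l : ℕ) : ℝ) * ((l ^ 2 * n ^ (l - 2) : ℕ) : ℝ)))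
        = (p : ℝ) ^ (2 * k) * (1 - p) * (1 * (n ^ l / D) ^ 2) := by
          push_cast
          rw [hc, hpow]
          field_simp
      _ ≤ (p : ℝ) ^ (2 * k) * (1 - p) * (k * Fintype.card (Placement H n) ^ 2) := by
          have h5 : (n : ℝ) ^ l / D ≤ Fintype.card (Placement H n) := by
            rw [div_le_iff₀ hD0, mul_comm]
            exact h3
          gcongr
      _ ≤ _ := h1
      _ ≤ _ := by gcongr
  have hb : 0 < l ^ 2 * n ^ (l - 2) := by positivity
  have hv0 : 0 < Dissociated.sumMoment (expectation (Fin n) p)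
      (centredContains p (Placement.edges (H := H))) 2 :=
    lt_of_lt_of_le (by positivity) hvar
  rw [variance_eq_sumMoment hdiag subgraphCount_eq_sum,
    integral_standardised_pow hdiag subgraphCount_eq_sum]
  refine ⟨hv0, (hC hdis hsparse hb hvar).trans_eq ?_⟩
  push_cast
  rw [hpow]
  field_simp

end SimpleGraph

theorem mainTheorem10 (p : unitInterval) (hp0 : 0 < (p : ℝ)) (hp1 : (p : ℝ) < 1)
    (m : ℕ) (hm : Even m) :
    (∀ k l : ℕ, 1 ≤ k →
      ∃ C : ℝ, ∀ (V : Type*) [Fintype V] (H : SimpleGraph V),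
        H.edgeSet.ncard = k → Fintype.card V = l →
        ∀ n : ℕ, l ≤ n →
          0 < variance (subgraphCount H n) (SimpleGraph.binomialRandom (Fin n) p) ∧
          |(∫ G, standardised (SimpleGraph.binomialRandom (Fin n) p) (subgraphCount H n) G ^ m
              ∂(SimpleGraph.binomialRandom (Fin n) p)) - normalMoment m| ≤ C / (n : ℝ) ^ 2) ∧
    (∃ C : ℝ, ∀ n : ℕ, 3 ≤ n →
      0 < variance (triangleCount n) (SimpleGraph.binomialRandom (Fin n) p) ∧
      |(∫ G, standardised (SimpleGraph.binomialRandom (Fin n) p) (triangleCount n) G ^ m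
          ∂(SimpleGraph.binomialRandom (Fin n) p)) - normalMoment m| ≤ C / (n : ℝ) ^ 2) := by
  refine ⟨fun k l hk => SimpleGraph.exists_subgraphCount_moment_bound p hp0 hp1 hm l hk, ?_⟩
  obtain ⟨C, hC⟩ := SimpleGraph.exists_subgraphCount_moment_bound p hp0 hp1 hm 3
    (show 1 ≤ 3 by norm_num)
  refine ⟨C, fun n hn => ?_⟩
  rw [SimpleGraph.triangleCount_eq_subgraphCount]
  refine hC (Fin 3) ⊤ ?_ (Fintype.card_fin 3) n hn
  classical
  rw [← SimpleGraph.coe_edgeFinset, Set.ncard_coe_finset,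
    SimpleGraph.card_edgeFinset_top_eq_card_choose_two]
  rfl
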